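/- Let $h>0$, $q\ge 0$ and $m,p\in\mathbb R$, and consider the delayed equation $$u_t(t,x)=u_{xx}(t,x)+m\,u_x(t,x)+p\,u(t,x)+q\,u(t-h,x),\qquad t>0,\ x\in\mathbb R. \tag{1}$$ The equation $q e^{-\sigma h}=\sigma+\frac{m^2}{4}-p$ has exactly one real solution $\sigma$. Let $u_0:\mathbb R\to\mathbb R$ satisfy $e^{\frac m2\cdot}u_0\in L^1(\mathbb R)$, and let $u$ be the solution of (1) generated by the initial data $u(s,\cdot)=e^{\sigma s}u_0$, $s\in[-h,0]$. Here a solution is a mild solution in the weighted $L^1$ phase space: $u$ is measurable, $t\mapsto e^{\frac m2\cdot}u(t,\cdot)$ is continuous from $[-h,\infty)$ to $L^1(\mathbb R)$, and for all $t>0$, $x\in\mathbb R$, $$u(t,x)=\int_{\mathbb R}K_t(x-y)u(0,y)\,dy+q\int_0^t\!\int_{\mathbb R}K_{t-s}(x-y)\,u(s-h,y)\,dy\,ds,\qquad K_t(x)=\frac{e^{pt}}{\sqrt{4\pi t}}\,e^{-\frac{(x+mt)^2}{4t}}.$$ Then for every $x\in\mathbb R$ and every function $r$ with $r(t)=o(\sqrt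 t)$ as $t\to\infty$, $$\lim_{t\to\infty}\sqrt t\,e^{-\sigma t}\,e^{\frac m2 r(t)}\,u(t,x+r(t))=\frac{\sqrt{1+hqe^{-\sigma h}}}{2\sqrt\pi}\,e^{-\frac m2x}\int_{\mathbb R}e^{\frac m2y}u_0(y)\,dy .$$ In particular, if moreover $m\,r(t)\to0$ (for instance if $m=0$, or if $r\equiv 0$), then $$\lim_{t\to\infty}\sqrt t\,e^{-\sigma t}\,u(t,x+r(t))=\frac{\sqrt{1+hqe^{-\sigma h}}}{2\sqrt\pi}\,e^{-\frac m2x}\int_{\mathbb R}e^{\frac m2y}u_0(y)\,dy .$$ -/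

import Mathlib

open Filter Topology MeasureTheory Asymptotics

/-- The kernel of the semigroup generated by `∂ₓₓ + m ∂ₓ + p` on the line (for `t > 0`):
the fundamental solution of `w_t = w_xx + m w_x + p w`. -/
noncomputable def driftHeatKernel (m p t x : ℝ) : ℝ :=
  Real.exp (p * t) / Real.sqrt (4 * Real.pi * t) * Real.exp (-(x + m * t) ^ 2 / (4 * t))

/-- `u` is the (mild) solution of the delayed equation
`u_t(t,x) = u_xx(t,x) + m u_x(t,x) + p u(t,x) + q u(t-h,x+d)`, `t > 0`, `x ∈ ℝ`,
generated by the initial history `φ` on `[-h,0]`, in the phase space of the curves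
`t ↦ u(t,·)` that are continuous with values in `L¹(ℝ, e^{mx/2} dx)`. -/
structure IsMildSolution (m p q d h : ℝ) (φ u : ℝ → ℝ → ℝ) : Prop where
  /-- joint measurability on `[-h,∞) × ℝ` -/
  aestronglyMeasurable : AEStronglyMeasurable (Function.uncurry u)
    ((volume : Measure (ℝ × ℝ)).restrict (Set.Ici (-h) ×ˢ Set.univ))
  /-- each `u(t,·)` lies in the weighted `L¹` space -/
  integrable : ∀ t, -h ≤ t → Integrable (fun x => Real.exp (m / 2 * x) * u t x)
  /-- continuity in time with respect to the weighted `L¹` norm -/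
  continuous : ∀ t₀, -h ≤ t₀ →
    Tendsto (fun t => ∫ x, Real.exp (m / 2 * x) * |u t x - u t₀ x|) (𝓝[Set.Ici (-h)] t₀) (𝓝 0)
  /-- the initial condition on `[-h,0]` -/
  initial : ∀ s ∈ Set.Icc (-h) 0, ∀ x, u s x = φ s x
  /-- the equation for `t > 0`, in variation-of-constants form -/
  duhamel : ∀ t, 0 < t → ∀ x,
    u t x = (∫ y, driftHeatKernel m p t (x - y) * u 0 y)
      + q * ∫ s in (0 : ℝ)..t, ∫ y, driftHeatKernel m p (t - s) (x - y) * u (s - h) (y + d)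

/-!
The gauge transformation `V(t,x) = e^{-σt} e^{mx/2} u(t,x)` turns the equation into
`V_t = V_xx - a V + a V(t-h,·)` with `a = q e^{-σh} ≥ 0`, and the choice of `σ` makes the history of
`V` constant in time, equal to `v₀ = e^{mx/2} u₀` (`IsMildSolution.gauge`). It remains to show
`√t V(t, y(t)) → √(1+ah) / (2√π) ∫ v₀` whenever `y(t) = o(√t)` (`IsMildSolution.tendsto_sqrt_mul`).

On the Fourier side every frequency solves the scalar delay equation
`z' = -(ξ² + a) z + a z(· - h)` with a constant history (`IsMildSolution.angularFourier_eq`), and `V`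
is recovered from its transform at every point `x`, because the Gaussian factors in the Duhamel
formula make all the integrals absolutely convergent (`IsMildSolution.eq_integral_angularFourier`).

The scalar equation obeys a comparison principle (`IsDelaySolution.norm_le`), and two explicit
exponentials serve as barriers: `(1 + hξ²/(1+ah))^{-t/h}` is a supersolution and
`e^{-ξ²(t+h)/(1+ah)}` a subsolution, lying respectively above and below `1` on `[-h,0]`
(`IsDelaySolution.norm_sub_barrier_le`). No asymptotic analysis of the characteristic roots is
needed: on the scale `ξ = η/√t` both barriers tend to `e^{-η²/(1+ah)}`, and for `t ≥ h` the upper one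
is at most `(1 + η²/(1+ah))⁻¹` by Bernoulli's inequality. Dominated convergence in the inversion
formula gives the limit `(2π)⁻¹ ∫ v₀ · ∫ e^{-η²/(1+ah)} dη`.
-/

/-! ### The Fourier transform of a real function -/

/-- The Fourier transform `ξ ↦ ∫ e^{-iξx} f(x) dx` of a real function on the line, in the
angular-frequency normalization. -/
noncomputable def angularFourier (f : ℝ → ℝ) (ξ : ℝ) : ℂ :=
  ∫ x : ℝ, Complex.exp (-(Complex.I * ξ * x)) * (f x : ℂ)

theorem norm_exp_neg_I_mul (ξ x : ℝ) : ‖Complex.exp (-(Complex.I * ξ * x))‖ = 1 := by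
  have : -(Complex.I * ξ * x) = ((-(ξ * x) : ℝ) : ℂ) * Complex.I := by push_cast; ring
  rw [this, Complex.norm_exp_ofReal_mul_I]

theorem norm_exp_I_mul (ξ x : ℝ) : ‖Complex.exp (Complex.I * ξ * x)‖ = 1 := by
  have : Complex.I * ξ * x = ((ξ * x : ℝ) : ℂ) * Complex.I := by push_cast; ring
  rw [this, Complex.norm_exp_ofReal_mul_I]

theorem integrable_exp_mul_ofReal {f : ℝ → ℝ} (hf : Integrable f) (ξ : ℝ) :
    Integrable (fun x : ℝ => Complex.exp (-(Complex.I * ξ * x)) * (f x : ℂ)) := by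
  refine hf.ofReal.bdd_mul (c := 1) (by fun_prop) (Eventually.of_forall fun x => ?_)
  rw [norm_exp_neg_I_mul]

theorem norm_angularFourier_le (f : ℝ → ℝ) (ξ : ℝ) : ‖angularFourier f ξ‖ ≤ ∫ x, |f x| := by
  refine (norm_integral_le_integral_norm _).trans_eq ?_
  simp [norm_exp_neg_I_mul]

theorem angularFourier_sub {f g : ℝ → ℝ} (hf : Integrable f) (hg : Integrable g) (ξ : ℝ) :
    angularFourier f ξ - angularFourier g ξ = angularFourier (fun x => f x - g x) ξ := by
  unfold angularFourier
  rw [← integral_sub (integrable_exp_mul_ofReal hf ξ) (integrable_exp_mul_ofReal hg ξ)]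
  congr 1
  ext x
  push_cast
  ring

theorem continuous_angularFourier {f : ℝ → ℝ} (hf : Integrable f) :
    Continuous (angularFourier f) := by
  refine continuous_of_dominated (bound := fun x => |f x|)
    (fun ξ => (integrable_exp_mul_ofReal hf ξ).aestronglyMeasurable)
    (fun ξ => Eventually.of_forall fun x => ?_) hf.abs (Eventually.of_forall fun x => ?_)
  · simp [norm_exp_neg_I_mul]
  · fun_prop

theorem angularFourier_zero (f : ℝ → ℝ) : angularFourier f 0 = ((∫ x, f x : ℝ) : ℂ) := by
  simp [angularFourier, integral_complex_ofReal]

/-! ### The damped heat kernel and its superpositions -/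

theorem driftHeatKernel_zero (a t x : ℝ) :
    driftHeatKernel 0 (-a) t x
      = Real.exp (-a * t) / Real.sqrt (4 * Real.pi * t) * Real.exp (-(1 / (4 * t)) * x ^ 2) := by
  unfold driftHeatKernel
  congr 2
  ring

theorem driftHeatKernel_nonneg (m p t x : ℝ) : 0 ≤ driftHeatKernel m p t x := by
  unfold driftHeatKernel
  positivity

theorem measurable_driftHeatKernel (m p : ℝ) :
    Measurable (fun z : ℝ × ℝ => driftHeatKernel m p z.1 z.2) := by
  unfold driftHeatKernel
  fun_prop

theorem integrable_driftHeatKernel_zero (a : ℝ) {t : ℝ} (ht : 0 < t) :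
    Integrable (driftHeatKernel 0 (-a) t) := by
  have : driftHeatKernel 0 (-a) t = _ := funext (driftHeatKernel_zero a t)
  rw [this]
  exact (integrable_exp_neg_mul_sq (by positivity)).const_mul _

theorem angularFourier_driftHeatKernel_zero (a : ℝ) {t : ℝ} (ht : 0 < t) (ξ : ℝ) :
    angularFourier (driftHeatKernel 0 (-a) t) ξ = (Real.exp (-(ξ ^ 2 + a) * t) : ℂ) := by
  have hb : 0 < ((1 / (4 * t) : ℝ) : ℂ).re := by
    rw [Complex.ofReal_re]; positivity
  have key := fourierIntegral_gaussian hb (-ξ : ℂ)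
  have hs : ((Real.pi : ℂ) / ((1 / (4 * t) : ℝ) : ℂ)) ^ (1 / 2 : ℂ)
      = (Real.sqrt (4 * Real.pi * t) : ℂ) := by
    rw [Real.sqrt_eq_rpow, Complex.ofReal_cpow (by positivity)]
    congr 1
    · push_cast; field_simp
    · push_cast; rfl
  have h0 : (Real.sqrt (4 * Real.pi * t) : ℂ) ≠ 0 := by
    exact_mod_cast (Real.sqrt_pos.mpr (by positivity)).ne'
  have ht' : (t : ℂ) ≠ 0 := by exact_mod_cast ht.ne'
  unfold angularFourier
  calc _ = ∫ x : ℝ, (Real.exp (-a * t) / Real.sqrt (4 * Real.pi * t) : ℂ) *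
        (Complex.exp (Complex.I * (-ξ) * x) *
          Complex.exp (-((1 / (4 * t) : ℝ) : ℂ) * x ^ 2)) := by
        congr 1
        ext x
        rw [driftHeatKernel_zero]
        push_cast
        rw [show -(Complex.I * ξ * x) = Complex.I * (-ξ) * x by ring]
        ring
    _ = _ := by
        rw [integral_const_mul, key, hs]
        push_cast
        rw [div_mul_eq_mul_div, mul_div_assoc, mul_div_cancel_left₀ _ h0, ← Complex.exp_add]
        congr 1
        field_simp
        ring

theorem integral_driftHeatKernel_zero (a : ℝ) {t : ℝ} (ht : 0 < t) :
    ∫ x, driftHeatKernel 0 (-a) t x = Real.exp (-a * t) := by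
  have h := angularFourier_driftHeatKernel_zero a ht 0
  rw [angularFourier_zero] at h
  have h' := Complex.ofReal_injective h
  rw [h']
  congr 1
  ring

theorem integrable_exp_neg_sq_add_mul (a : ℝ) {t : ℝ} (ht : 0 < t) :
    Integrable (fun ξ : ℝ => Real.exp (-(ξ ^ 2 + a) * t)) := by
  have := (integrable_exp_neg_mul_sq ht).const_mul (Real.exp (-a * t))
  refine this.congr (Eventually.of_forall fun ξ => ?_)
  simp only
  rw [← Real.exp_add]
  congr 1
  ring

theorem integral_exp_neg_sq_add_mul (a t : ℝ) :
    ∫ ξ : ℝ, Real.exp (-(ξ ^ 2 + a) * t) = Real.exp (-a * t) * Real.sqrt (Real.pi / t) := by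
  rw [← integral_gaussian, ← integral_const_mul]
  congr 1
  ext ξ
  rw [← Real.exp_add]
  congr 1
  ring

theorem driftHeatKernel_zero_eq_integral (a : ℝ) {t : ℝ} (ht : 0 < t) (x : ℝ) :
    (driftHeatKernel 0 (-a) t x : ℂ) = 1 / (2 * Real.pi) *
      ∫ ξ : ℝ, Complex.exp (Complex.I * ξ * x) * (Real.exp (-(ξ ^ 2 + a) * t) : ℂ) := by
  have key := fourierIntegral_gaussian (b := (t : ℂ)) (by simpa using ht) (x : ℂ)
  have hs : ((Real.pi : ℂ) / t) ^ (1 / 2 : ℂ) = (Real.sqrt (Real.pi / t) : ℂ) := by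
    rw [Real.sqrt_eq_rpow, Complex.ofReal_cpow (by positivity)]
    push_cast
    rfl
  have hsq : Real.sqrt (Real.pi / t) * Real.sqrt (4 * Real.pi * t) = 2 * Real.pi := by
    rw [← Real.sqrt_mul (by positivity),
      show Real.pi / t * (4 * Real.pi * t) = (2 * Real.pi) ^ 2 by field_simp; ring]
    exact Real.sqrt_sq (by positivity)
  have h0 : Real.sqrt (4 * Real.pi * t) ≠ 0 := (Real.sqrt_pos.mpr (by positivity)).ne'
  have ht' : (t : ℂ) ≠ 0 := by exact_mod_cast ht.ne'
  have e1 : ∫ ξ : ℝ, Complex.exp (Complex.I * ξ * x) * (Real.exp (-(ξ ^ 2 + a) * t) : ℂ)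
      = (Real.exp (-a * t) : ℂ) *
        ∫ ξ : ℝ, Complex.exp (Complex.I * x * ξ) * Complex.exp (-(t : ℂ) * ξ ^ 2) := by
    rw [← integral_const_mul]
    congr 1
    ext ξ
    rw [← Complex.exp_add]
    push_cast
    rw [← Complex.exp_add, ← Complex.exp_add]
    congr 1
    ring
  rw [e1, key, hs, driftHeatKernel_zero]
  have e2 : Complex.exp (-(x : ℂ) ^ 2 / (4 * t)) = (Real.exp (-(1 / (4 * t)) * x ^ 2) : ℂ) := by
    push_cast
    congr 1
    field_simp
  rw [e2]
  have e3 : Real.exp (-a * t) / Real.sqrt (4 * Real.pi * t) = 1 / (2 * Real.pi) *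
      (Real.exp (-a * t) * Real.sqrt (Real.pi / t)) := by
    rw [← hsq]
    have : Real.sqrt (Real.pi / t) ≠ 0 := (Real.sqrt_pos.mpr (by positivity)).ne'
    field_simp
  rw [e3]
  push_cast
  ring

/-- The damped heat flow of `f` as a Fourier integral, at every point. -/
theorem driftHeatKernel_zero_conv_eq_integral (a : ℝ) {t : ℝ} (ht : 0 < t) {f : ℝ → ℝ}
    (hf : Integrable f) (x : ℝ) :
    ((∫ y, driftHeatKernel 0 (-a) t (x - y) * f y : ℝ) : ℂ) = 1 / (2 * Real.pi) *
      ∫ ξ : ℝ, Complex.exp (Complex.I * ξ * x) *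
        ((Real.exp (-(ξ ^ 2 + a) * t) : ℂ) * angularFourier f ξ) := by
  have hint : Integrable (Function.uncurry fun y ξ : ℝ =>
      Complex.exp (Complex.I * ξ * (x - y)) * (Real.exp (-(ξ ^ 2 + a) * t) : ℂ) * (f y : ℂ))
      (volume.prod volume) := by
    have h1 : Integrable (fun z : ℝ × ℝ => (f z.1 : ℂ) * (Real.exp (-(z.2 ^ 2 + a) * t) : ℂ))
        (volume.prod volume) :=
      hf.ofReal.mul_prod (integrable_exp_neg_sq_add_mul a ht).ofReal
    have h2 := h1.bdd_mul (c := 1)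
      (f := fun z : ℝ × ℝ => Complex.exp (Complex.I * z.2 * ((x - z.1 : ℝ) : ℂ)))
      (by fun_prop) (Eventually.of_forall fun z => by rw [norm_exp_I_mul])
    refine h2.congr (Eventually.of_forall fun z => ?_)
    simp only [Function.uncurry]
    push_cast
    ring
  rw [← integral_complex_ofReal]
  have e1 : ∀ y : ℝ, ((driftHeatKernel 0 (-a) t (x - y) * f y : ℝ) : ℂ) = 1 / (2 * Real.pi) *
      ∫ ξ : ℝ, Complex.exp (Complex.I * ξ * (x - y)) * (Real.exp (-(ξ ^ 2 + a) * t) : ℂ)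
        * (f y : ℂ) := by
    intro y
    rw [integral_mul_const, Complex.ofReal_mul, driftHeatKernel_zero_eq_integral a ht]
    push_cast
    ring
  simp_rw [e1]
  rw [integral_const_mul, integral_integral_swap hint]
  congr 2
  ext ξ
  unfold angularFourier
  rw [← integral_const_mul, ← integral_const_mul]
  congr 1
  ext y
  rw [show Complex.I * ξ * (x - y) = Complex.I * ξ * x + -(Complex.I * ξ * y) by ring,
    Complex.exp_add]
  ring

theorem integral_exp_mul_driftHeatKernel_sub (a : ℝ) {t : ℝ} (ht : 0 < t) (ξ y : ℝ) :
    ∫ x : ℝ, Complex.exp (-(Complex.I * ξ * x)) * (driftHeatKernel 0 (-a) t (x - y) : ℂ)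
      = (Real.exp (-(ξ ^ 2 + a) * t) : ℂ) * Complex.exp (-(Complex.I * ξ * y)) := by
  rw [← angularFourier_driftHeatKernel_zero a ht ξ, angularFourier, ← integral_mul_const,
    ← integral_sub_right_eq_self (fun x : ℝ => Complex.exp (-(Complex.I * ξ * x)) *
      (driftHeatKernel 0 (-a) t x : ℂ) * Complex.exp (-(Complex.I * ξ * y))) y]
  congr 1
  ext x
  rw [show -(Complex.I * ξ * x) = -(Complex.I * ξ * ((x - y : ℝ) : ℂ)) + -(Complex.I * ξ * y) by
    push_cast; ring, Complex.exp_add]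
  ring

theorem angularFourier_congr_ae {f g : ℝ → ℝ} (hfg : f =ᵐ[volume] g) (ξ : ℝ) :
    angularFourier f ξ = angularFourier g ξ := by
  refine integral_congr_ae ?_
  filter_upwards [hfg] with x hx
  rw [hx]

theorem angularFourier_add_const_mul {f g : ℝ → ℝ} (hf : Integrable f) (hg : Integrable g)
    (c ξ : ℝ) :
    angularFourier (fun x => f x + c * g x) ξ
      = angularFourier f ξ + c * angularFourier g ξ := by
  unfold angularFourier
  rw [← integral_const_mul, ← integral_add (integrable_exp_mul_ofReal hf ξ)
    ((integrable_exp_mul_ofReal hg ξ).const_mul _)]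
  congr 1
  ext x
  push_cast
  ring

theorem angularFourier_driftHeatKernel_sub_mul (a : ℝ) {t : ℝ} (ht : 0 < t) (y c ξ : ℝ) :
    angularFourier (fun x => driftHeatKernel 0 (-a) t (x - y) * c) ξ
      = (Real.exp (-(ξ ^ 2 + a) * t) : ℂ) * (Complex.exp (-(Complex.I * ξ * y)) * (c : ℂ)) := by
  rw [← mul_assoc, ← integral_exp_mul_driftHeatKernel_sub a ht, ← integral_mul_const]
  unfold angularFourier
  congr 1
  ext x
  push_cast
  ring

/-- Superpositions of damped heat kernels, started at the points `y ω` with masses `w ω` and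
observed after the times `τ ω`: they are integrable on the product space. This covers both terms of
the Duhamel formula. -/
theorem integrable_driftHeatKernel_superposition {Ω : Type*} [MeasurableSpace Ω] {μ : Measure Ω}
    [SFinite μ] {a : ℝ} (ha : 0 ≤ a) {τ y w : Ω → ℝ} (hτ : Measurable τ) (hy : Measurable y)
    (hw : Integrable w μ) (hpos : ∀ᵐ ω ∂μ, 0 < τ ω) :
    Integrable (fun z : ℝ × Ω => driftHeatKernel 0 (-a) (τ z.2) (z.1 - y z.2) * w z.2)
      (volume.prod μ) := by
  have hm : AEStronglyMeasurable
      (fun z : ℝ × Ω => driftHeatKernel 0 (-a) (τ z.2) (z.1 - y z.2) * w z.2)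
      (volume.prod μ) := by
    refine AEStronglyMeasurable.mul ?_ hw.aestronglyMeasurable.comp_snd
    exact ((measurable_driftHeatKernel 0 (-a)).comp ((hτ.comp measurable_snd).prodMk
      (measurable_fst.sub (hy.comp measurable_snd)))).aestronglyMeasurable
  rw [integrable_prod_iff' hm]
  constructor
  · filter_upwards [hpos] with ω hω
    exact ((integrable_driftHeatKernel_zero a hω).comp_sub_right (y ω)).mul_const _
  · -- truncating `τ` at zero makes the exponential factor bounded by `1` everywhere
    have hb : Integrable (fun ω => Real.exp (-a * max (τ ω) 0) * |w ω|) μ := by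
      refine hw.abs.bdd_mul (c := 1) ?_ (Eventually.of_forall fun ω => ?_)
      · exact Measurable.aestronglyMeasurable (by fun_prop)
      · rw [Real.norm_eq_abs, Real.abs_exp, Real.exp_le_one_iff]
        have := mul_nonneg ha (le_max_right (τ ω) 0)
        linarith
    refine hb.congr ?_
    filter_upwards [hpos] with ω hω
    simp only [norm_mul, Real.norm_eq_abs, abs_of_nonneg (driftHeatKernel_nonneg _ _ _ _)]
    rw [integral_mul_const, integral_sub_right_eq_self (driftHeatKernel 0 (-a) (τ ω)) (y ω),
      integral_driftHeatKernel_zero a hω, max_eq_left hω.le]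

theorem angularFourier_integral {Ω : Type*} [MeasurableSpace Ω] {μ : Measure Ω}
    [SFinite μ] {G : ℝ × Ω → ℝ} (hG : Integrable G (volume.prod μ)) (ξ : ℝ) :
    Integrable (fun ω => angularFourier (fun x => G (x, ω)) ξ) μ ∧
    angularFourier (fun x => ∫ ω, G (x, ω) ∂μ) ξ
      = ∫ ω, angularFourier (fun x => G (x, ω)) ξ ∂μ := by
  have hint : Integrable (Function.uncurry fun (x : ℝ) (ω : Ω) =>
      Complex.exp (-(Complex.I * ξ * x)) * (G (x, ω) : ℂ)) (volume.prod μ) := by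
    refine hG.ofReal.bdd_mul (c := 1)
      (f := fun z : ℝ × Ω => Complex.exp (-(Complex.I * ξ * (z.1 : ℝ))))
      ?_ (Eventually.of_forall fun z => by rw [norm_exp_neg_I_mul])
    exact Measurable.aestronglyMeasurable (by fun_prop)
  refine ⟨hint.integral_prod_right, ?_⟩
  unfold angularFourier
  rw [← integral_integral_swap hint]
  congr 1
  ext x
  rw [integral_const_mul, integral_complex_ofReal]

/-! ### Regularity of the Fourier transform of a solution -/

namespace IsMildSolution

variable {p q d h : ℝ} {φ V : ℝ → ℝ → ℝ}

theorem integrable_slice (hV : IsMildSolution 0 p q d h φ V) {t : ℝ} (ht : -h ≤ t) :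
    Integrable (V t) := by
  simpa using hV.integrable t ht

theorem tendsto_integral_abs_sub (hV : IsMildSolution 0 p q d h φ V) {t : ℝ} (ht : -h ≤ t) :
    Tendsto (fun s => ∫ x, |V s x - V t x|) (𝓝[Set.Ici (-h)] t) (𝓝 0) := by
  simpa using hV.continuous t ht

theorem continuousOn_integral_abs (hV : IsMildSolution 0 p q d h φ V) :
    ContinuousOn (fun s => ∫ x, |V s x|) (Set.Ici (-h)) := by
  intro t ht
  refine tendsto_iff_norm_sub_tendsto_zero.mpr ?_
  refine squeeze_zero' (Eventually.of_forall fun s => norm_nonneg _) ?_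
    (hV.tendsto_integral_abs_sub ht)
  filter_upwards [self_mem_nhdsWithin] with s hs
  have h1 := hV.integrable_slice hs
  have h2 := hV.integrable_slice ht
  rw [← integral_sub h1.abs h2.abs]
  refine (norm_integral_le_integral_norm _).trans ?_
  exact integral_mono (h1.abs.sub h2.abs).norm (h1.sub h2).abs fun x => abs_abs_sub_abs_le _ _

theorem continuousOn_angularFourier (hV : IsMildSolution 0 p q d h φ V) :
    ContinuousOn (fun z : ℝ × ℝ => angularFourier (V z.1) z.2) (Set.Ici (-h) ×ˢ Set.univ) := by
  rintro ⟨t, ξ⟩ ⟨ht, -⟩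
  have ht : -h ≤ t := ht
  have h2 := hV.integrable_slice ht
  refine tendsto_iff_norm_sub_tendsto_zero.mpr ?_
  have hfst : Tendsto (fun z : ℝ × ℝ => z.1) (𝓝[Set.Ici (-h) ×ˢ Set.univ] (t, ξ))
      (𝓝[Set.Ici (-h)] t) := by
    refine tendsto_nhdsWithin_iff.mpr ⟨(continuous_fst.tendsto (t, ξ)).mono_left
      nhdsWithin_le_nhds, ?_⟩
    filter_upwards [self_mem_nhdsWithin] with z hz using hz.1
  have hsnd : Tendsto (fun z : ℝ × ℝ => ‖angularFourier (V t) z.2 - angularFourier (V t) ξ‖)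
      (𝓝[Set.Ici (-h) ×ˢ Set.univ] (t, ξ)) (𝓝 0) := by
    have hc : Continuous fun z : ℝ × ℝ => ‖angularFourier (V t) z.2 - angularFourier (V t) ξ‖ :=
      (((continuous_angularFourier h2).comp continuous_snd).sub continuous_const).norm
    simpa using (hc.tendsto (t, ξ)).mono_left
      (nhdsWithin_le_nhds (s := Set.Ici (-h) ×ˢ Set.univ))
  have hsum := ((hV.tendsto_integral_abs_sub ht).comp hfst).add hsnd
  rw [add_zero] at hsum
  refine squeeze_zero' (Eventually.of_forall fun z => norm_nonneg _) ?_ hsum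
  filter_upwards [self_mem_nhdsWithin] with z hz
  have h1 := hV.integrable_slice hz.1
  refine (norm_sub_le_norm_sub_add_norm_sub _ (angularFourier (V t) z.2) _).trans ?_
  gcongr
  rw [angularFourier_sub h1 h2]
  exact norm_angularFourier_le _ _

theorem continuousOn_angularFourier_delay (hV : IsMildSolution 0 p q d h φ V) (ξ : ℝ) :
    ContinuousOn (fun s => angularFourier (V (s - h)) ξ) (Set.Ici 0) := by
  refine hV.continuousOn_angularFourier.comp (f := fun s : ℝ => (s - h, ξ)) (by fun_prop) ?_
  intro s hs
  simp only [Set.mem_Ici] at hs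
  simpa using hs

theorem integrable_delay_prod (hV : IsMildSolution 0 p q d h φ V) (t : ℝ) :
    Integrable (fun z : ℝ × ℝ => V (z.1 - h) z.2)
      ((volume.restrict (Set.Ioc 0 t)).prod volume) := by
  have hmp : MeasurePreserving (Prod.map (fun s : ℝ => s - h) (id : ℝ → ℝ))
      ((volume.restrict ((fun s : ℝ => s - h) ⁻¹' Set.Ici (-h))).prod volume)
      ((volume.restrict (Set.Ici (-h))).prod volume) :=
    ((measurePreserving_sub_right volume h).restrict_preimage measurableSet_Ici).prod
      (MeasurePreserving.id volume)
  have hle : (volume.restrict (Set.Ioc 0 t)).prod (volume : Measure ℝ)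
      ≤ (volume.restrict ((fun s : ℝ => s - h) ⁻¹' Set.Ici (-h))).prod volume := by
    refine Measure.prod_mono (Measure.restrict_mono (fun s hs => ?_) le_rfl) le_rfl
    simpa using hs.1.le
  have hm : AEStronglyMeasurable (fun z : ℝ × ℝ => V (z.1 - h) z.2)
      ((volume.restrict (Set.Ioc 0 t)).prod volume) := by
    have h1 := hV.aestronglyMeasurable
    rw [Measure.volume_eq_prod, ← Measure.prod_restrict, Measure.restrict_univ] at h1
    exact (h1.comp_measurePreserving hmp).mono_measure hle
  rw [integrable_prod_iff hm]
  constructor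
  · filter_upwards [ae_restrict_mem measurableSet_Ioc] with s hs
    exact hV.integrable_slice (by linarith [hs.1])
  · have hc : ContinuousOn (fun s => ∫ x, |V (s - h) x|) (Set.Icc 0 t) := by
      refine hV.continuousOn_integral_abs.comp (f := fun s : ℝ => s - h) (by fun_prop) ?_
      intro s hs
      simpa using hs.1
    exact (hc.integrableOn_Icc).mono_set Set.Ioc_subset_Icc_self

end IsMildSolution

/-! ### The delayed heat equation on the Fourier side -/

/-- The integral over `ξ` is of order `(t - s)^{-1/2}`, which is integrable up to `s = t`. -/
theorem integrable_exp_neg_sq_add_mul_prod {a : ℝ} (ha : 0 ≤ a) (t : ℝ) :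
    Integrable (fun z : ℝ × ℝ => Real.exp (-(z.2 ^ 2 + a) * (t - z.1)))
      ((volume.restrict (Set.Ioo 0 t)).prod volume) := by
  have hm : AEStronglyMeasurable (fun z : ℝ × ℝ => Real.exp (-(z.2 ^ 2 + a) * (t - z.1)))
      ((volume.restrict (Set.Ioo 0 t)).prod volume) :=
    Continuous.aestronglyMeasurable (by fun_prop)
  rw [integrable_prod_iff hm]
  constructor
  · filter_upwards [ae_restrict_mem measurableSet_Ioo] with s hs
    exact integrable_exp_neg_sq_add_mul a (by linarith [hs.2])
  · simp only [Real.norm_eq_abs, Real.abs_exp, integral_exp_neg_sq_add_mul]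
    have hr : IntervalIntegrable (fun s : ℝ => (t - s) ^ (-(1 / 2) : ℝ)) volume 0 t := by
      have := (intervalIntegral.intervalIntegrable_rpow' (a := 0) (b := t)
        (r := -(1 / 2)) (by norm_num)).comp_sub_left t
      simpa using this.symm
    have hr' : IntegrableOn (fun s : ℝ => (t - s) ^ (-(1 / 2) : ℝ)) (Set.Ioo 0 t) :=
      hr.1.mono_set Set.Ioo_subset_Ioc_self
    refine Integrable.mono' (hr'.const_mul (Real.sqrt Real.pi))
      (Measurable.aestronglyMeasurable (by fun_prop)) ?_
    filter_upwards [ae_restrict_mem measurableSet_Ioo] with s hs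
    have hts : 0 < t - s := by linarith [hs.2]
    rw [Real.norm_eq_abs, abs_of_nonneg (by positivity), Real.sqrt_div Real.pi_pos.le,
      Real.rpow_neg hts.le, ← Real.sqrt_eq_rpow, div_eq_mul_inv]
    refine mul_le_of_le_one_left (by positivity) ?_
    rw [Real.exp_le_one_iff]
    have := mul_nonneg ha hts.le
    linarith

namespace IsMildSolution

variable {a h : ℝ} {φ V : ℝ → ℝ → ℝ}

/-- Each frequency of a solution solves the scalar delay equation `z' = -(ξ² + a) z + a z(· - h)`,
in variation-of-constants form. -/
theorem angularFourier_eq (ha : 0 ≤ a) (hh : 0 < h) (hV : IsMildSolution 0 (-a) a 0 h φ V)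
    {t : ℝ} (ht : 0 < t) (ξ : ℝ) :
    angularFourier (V t) ξ = (Real.exp (-(ξ ^ 2 + a) * t) : ℂ) * angularFourier (V 0) ξ
      + a * ∫ s in Set.Ioo 0 t,
          (Real.exp (-(ξ ^ 2 + a) * (t - s)) : ℂ) * angularFourier (V (s - h)) ξ := by
  have hV0 : Integrable (V 0) := hV.integrable_slice (by linarith)
  have hA := integrable_driftHeatKernel_superposition (μ := volume) ha
    (τ := fun _ : ℝ => t) (y := fun y => y) measurable_const measurable_id hV0
    (Eventually.of_forall fun _ => ht)
  have hw : Integrable (fun z : ℝ × ℝ => V (z.1 - h) z.2)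
      ((volume.restrict (Set.Ioo 0 t)).prod volume) := by
    rw [restrict_Ioo_eq_restrict_Ioc]
    exact hV.integrable_delay_prod t
  -- the open interval excludes `s = t`, where the kernel degenerates
  have hpos : ∀ᵐ z : ℝ × ℝ ∂((volume.restrict (Set.Ioo 0 t)).prod volume), 0 < t - z.1 := by
    refine Measure.quasiMeasurePreserving_fst.ae (p := fun s : ℝ => 0 < t - s) ?_
    filter_upwards [ae_restrict_mem measurableSet_Ioo] with s hs
    linarith [hs.2]
  have hB := integrable_driftHeatKernel_superposition ha
    (τ := fun z : ℝ × ℝ => t - z.1) (y := fun z : ℝ × ℝ => z.2) (by fun_prop) (by fun_prop) hw hpos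
  have hsplit : V t =ᵐ[volume] fun x => (∫ y, driftHeatKernel 0 (-a) t (x - y) * V 0 y)
      + a * ∫ z : ℝ × ℝ, driftHeatKernel 0 (-a) (t - z.1) (x - z.2) * V (z.1 - h) z.2
        ∂((volume.restrict (Set.Ioo 0 t)).prod volume) := by
    filter_upwards [hB.prod_right_ae] with x hx
    rw [hV.duhamel t ht x, integral_prod _ hx, intervalIntegral.integral_of_le ht.le,
      ← restrict_Ioo_eq_restrict_Ioc]
    simp only [add_zero]
  obtain ⟨-, hA2⟩ := angularFourier_integral hA ξ
  obtain ⟨hB1, hB2⟩ := angularFourier_integral hB ξ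
  have hcongr : (fun z : ℝ × ℝ => angularFourier
      (fun x => driftHeatKernel 0 (-a) (t - z.1) (x - z.2) * V (z.1 - h) z.2) ξ)
      =ᵐ[(volume.restrict (Set.Ioo 0 t)).prod volume] fun z =>
        (Real.exp (-(ξ ^ 2 + a) * (t - z.1)) : ℂ) *
          (Complex.exp (-(Complex.I * ξ * z.2)) * (V (z.1 - h) z.2 : ℂ)) := by
    filter_upwards [hpos] with z hz
    exact angularFourier_driftHeatKernel_sub_mul a hz _ _ ξ
  rw [angularFourier_congr_ae hsplit,
    angularFourier_add_const_mul hA.integral_prod_left hB.integral_prod_left, hA2, hB2,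
    integral_congr_ae hcongr, integral_prod _ (hB1.congr hcongr)]
  congr 1
  · simp_rw [angularFourier_driftHeatKernel_sub_mul a ht]
    rw [integral_const_mul]
    rfl
  · congr 2
    ext s
    dsimp only
    rw [integral_const_mul]
    rfl

/-- Fourier inversion for a solution, valid at every point `x` and not merely almost everywhere:
the Gaussian factors in the Duhamel formula make all integrals absolutely convergent. -/
theorem eq_integral_angularFourier (ha : 0 ≤ a) (hh : 0 < h)
    (hV : IsMildSolution 0 (-a) a 0 h φ V) {t : ℝ} (ht : 0 < t) (x : ℝ) :
    (V t x : ℂ) = 1 / (2 * Real.pi) *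
      ∫ ξ : ℝ, Complex.exp (Complex.I * ξ * x) * angularFourier (V t) ξ := by
  have hV0 : Integrable (V 0) := hV.integrable_slice (by linarith)
  have hJ : Integrable (fun z : ℝ × ℝ => Complex.exp (Complex.I * z.2 * x) *
      ((Real.exp (-(z.2 ^ 2 + a) * (t - z.1)) : ℂ) * angularFourier (V (z.1 - h)) z.2))
      ((volume.restrict (Set.Ioo 0 t)).prod volume) := by
    obtain ⟨M, hM⟩ : ∃ M, ∀ s ∈ Set.Icc (-h) t, ∫ x, |V s x| ≤ M := by
      obtain ⟨M, hM⟩ := isCompact_Icc.bddAbove_image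
        (hV.continuousOn_integral_abs.mono (fun s (hs : s ∈ Set.Icc (-h) t) => hs.1))
      exact ⟨M, fun s hs => hM ⟨s, hs, rfl⟩⟩
    have hFm : AEStronglyMeasurable (fun z : ℝ × ℝ => angularFourier (V (z.1 - h)) z.2)
        ((volume.restrict (Set.Ioo 0 t)).prod volume) := by
      have hc : ContinuousOn (fun z : ℝ × ℝ => angularFourier (V (z.1 - h)) z.2)
          (Set.Ioo 0 t ×ˢ Set.univ) := by
        refine hV.continuousOn_angularFourier.comp (f := fun z : ℝ × ℝ => (z.1 - h, z.2))
          (by fun_prop) ?_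
        rintro ⟨s, ξ⟩ ⟨hs, -⟩
        simpa using hs.1.le
      have := hc.aestronglyMeasurable (μ := volume) (measurableSet_Ioo.prod MeasurableSet.univ)
      rwa [Measure.volume_eq_prod, ← Measure.prod_restrict, Measure.restrict_univ] at this
    refine Integrable.mono' ((integrable_exp_neg_sq_add_mul_prod ha t).mul_const M) ?_ ?_
    · refine AEStronglyMeasurable.mul (Continuous.aestronglyMeasurable (by fun_prop))
        (AEStronglyMeasurable.mul (Continuous.aestronglyMeasurable (by fun_prop)) hFm)
    · have hmem : ∀ᵐ z : ℝ × ℝ ∂((volume.restrict (Set.Ioo 0 t)).prod volume),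
          z.1 ∈ Set.Ioo 0 t :=
        Measure.quasiMeasurePreserving_fst.ae (p := fun s : ℝ => s ∈ Set.Ioo 0 t)
          (ae_restrict_mem measurableSet_Ioo)
      filter_upwards [hmem] with z hz
      rw [norm_mul, norm_mul, norm_exp_I_mul, one_mul, Complex.norm_real, Real.norm_eq_abs,
        Real.abs_exp]
      gcongr
      exact (norm_angularFourier_le _ _).trans
        (hM _ ⟨by linarith [hz.1], by linarith [hz.2]⟩)
  have hE : Integrable (fun ξ : ℝ => Complex.exp (Complex.I * ξ * x) *
      ((Real.exp (-(ξ ^ 2 + a) * t) : ℂ) * angularFourier (V 0) ξ)) := by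
    refine Integrable.mono' ((integrable_exp_neg_sq_add_mul a ht).mul_const (∫ x, |V 0 x|)) ?_
      (Eventually.of_forall fun ξ => ?_)
    · exact Continuous.aestronglyMeasurable
        ((by fun_prop : Continuous fun ξ : ℝ => Complex.exp (Complex.I * ξ * x)).mul
          ((by fun_prop : Continuous fun ξ : ℝ => (Real.exp (-(ξ ^ 2 + a) * t) : ℂ)).mul
            (continuous_angularFourier hV0)))
    · rw [norm_mul, norm_mul, norm_exp_I_mul, one_mul, Complex.norm_real, Real.norm_eq_abs,
        Real.abs_exp]
      gcongr
      exact norm_angularFourier_le _ _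
  have hD : ((∫ s in (0 : ℝ)..t, ∫ y, driftHeatKernel 0 (-a) (t - s) (x - y) * V (s - h) (y + 0)
      : ℝ) : ℂ) = 1 / (2 * Real.pi) * ∫ ξ : ℝ, ∫ s in Set.Ioo 0 t,
        Complex.exp (Complex.I * ξ * x) *
          ((Real.exp (-(ξ ^ 2 + a) * (t - s)) : ℂ) * angularFourier (V (s - h)) ξ) := by
    rw [← integral_integral_swap hJ, intervalIntegral.integral_of_le ht.le,
      ← restrict_Ioo_eq_restrict_Ioc, ← integral_complex_ofReal, ← integral_const_mul]
    refine setIntegral_congr_fun measurableSet_Ioo fun s hs => ?_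
    simp only [add_zero]
    exact driftHeatKernel_zero_conv_eq_integral a (by linarith [hs.2])
      (hV.integrable_slice (by linarith [hs.1])) x
  rw [hV.duhamel t ht x, Complex.ofReal_add, Complex.ofReal_mul, hD,
    driftHeatKernel_zero_conv_eq_integral a ht hV0]
  have hsum : ∀ ξ : ℝ, Complex.exp (Complex.I * ξ * x) * angularFourier (V t) ξ
      = Complex.exp (Complex.I * ξ * x) *
          ((Real.exp (-(ξ ^ 2 + a) * t) : ℂ) * angularFourier (V 0) ξ)
        + a * ∫ s in Set.Ioo 0 t, Complex.exp (Complex.I * ξ * x) *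
          ((Real.exp (-(ξ ^ 2 + a) * (t - s)) : ℂ) * angularFourier (V (s - h)) ξ) := by
    intro ξ
    rw [hV.angularFourier_eq ha hh ht, integral_const_mul]
    ring
  simp_rw [hsum]
  rw [integral_add hE (hJ.integral_prod_right.const_mul _), integral_const_mul]
  ring

end IsMildSolution

/-! ### Barriers for the scalar delay equation -/

/-- `z` solves `z' = -c z + a z(· - h) + ρ` for `t > 0`, in variation-of-constants form; the
convergence of the integral is part of the definition. -/
def IsDelaySolution (c a h : ℝ) (ρ z : ℝ → ℂ) : Prop :=
  ∀ t, 0 < t →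
    IntegrableOn (fun s => (Real.exp (-c * (t - s)) : ℂ) * (a * z (s - h) + ρ s)) (Set.Ioo 0 t) ∧
    z t = (Real.exp (-c * t) : ℂ) * z 0
      + ∫ s in Set.Ioo 0 t, (Real.exp (-c * (t - s)) : ℂ) * (a * z (s - h) + ρ s)

namespace IsDelaySolution

variable {c a h : ℝ}

theorem linear_comb {ρ₁ ρ₂ z₁ z₂ : ℝ → ℂ} (h₁ : IsDelaySolution c a h ρ₁ z₁)
    (h₂ : IsDelaySolution c a h ρ₂ z₂) (α β : ℂ) :
    IsDelaySolution c a h (fun s => α * ρ₁ s + β * ρ₂ s) (fun s => α * z₁ s + β * z₂ s) := by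
  intro t ht
  obtain ⟨i₁, e₁⟩ := h₁ t ht
  obtain ⟨i₂, e₂⟩ := h₂ t ht
  have he : (fun s => (Real.exp (-c * (t - s)) : ℂ) *
        (a * (α * z₁ (s - h) + β * z₂ (s - h)) + (α * ρ₁ s + β * ρ₂ s)))
      = fun s => α * ((Real.exp (-c * (t - s)) : ℂ) * (a * z₁ (s - h) + ρ₁ s))
        + β * ((Real.exp (-c * (t - s)) : ℂ) * (a * z₂ (s - h) + ρ₂ s)) := by
    ext s
    ring
  rw [he]
  refine ⟨(i₁.const_mul α).add (i₂.const_mul β), ?_⟩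
  rw [integral_add (i₁.const_mul α) (i₂.const_mul β), integral_const_mul, integral_const_mul]
  dsimp only
  rw [e₁, e₂]
  ring

/-- An exponential solves the delay equation up to a multiple of itself, whose sign decides whether
it is a super- or a subsolution. -/
theorem exp (c a h κ : ℝ) :
    IsDelaySolution c a h
      (fun s => (((c - κ - a * Real.exp (κ * h)) * Real.exp (-κ * s) : ℝ) : ℂ))
      (fun s => (Real.exp (-κ * s) : ℂ)) := by
  intro t ht
  have he : (fun s : ℝ => (Real.exp (-c * (t - s)) : ℂ) * (a * (Real.exp (-κ * (s - h)) : ℂ)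
        + (((c - κ - a * Real.exp (κ * h)) * Real.exp (-κ * s) : ℝ) : ℂ)))
      = fun s : ℝ => ((Real.exp (-c * (t - s)) * Real.exp (-κ * s) * (c - κ) : ℝ) : ℂ) := by
    ext s
    rw [show -κ * (s - h) = κ * h + -κ * s by ring, Real.exp_add]
    push_cast
    ring
  simp only [he]
  have hc : Continuous fun s : ℝ => Real.exp (-c * (t - s)) * Real.exp (-κ * s) * (c - κ) := by
    fun_prop
  refine ⟨?_, ?_⟩
  · exact (Complex.continuous_ofReal.comp hc).integrableOn_Icc.mono_set Set.Ioo_subset_Icc_self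
  · have hd : ∀ s ∈ Set.uIcc 0 t, HasDerivAt
        (fun s : ℝ => Real.exp (-c * (t - s)) * Real.exp (-κ * s))
        (Real.exp (-c * (t - s)) * Real.exp (-κ * s) * (c - κ)) s := by
      intro s _
      have d1 : HasDerivAt (fun s : ℝ => -c * (t - s)) c s := by
        simpa using ((hasDerivAt_id s).const_sub t).const_mul (-c)
      have d2 : HasDerivAt (fun s : ℝ => -κ * s) (-κ) s := by
        simpa using (hasDerivAt_id s).const_mul (-κ)
      have := d1.exp.mul d2.exp
      refine this.congr_deriv ?_
      ring
    have hFTC := intervalIntegral.integral_eq_sub_of_hasDerivAt hd (hc.intervalIntegrable 0 t)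
    rw [intervalIntegral.integral_of_le ht.le, ← restrict_Ioo_eq_restrict_Ioc] at hFTC
    rw [integral_complex_ofReal, hFTC]
    push_cast
    simp

/-- The comparison principle, by steps of length `h`: on each step the delayed term is controlled
by the previous one. -/
theorem norm_le (hh : 0 < h) (ha : 0 ≤ a) {ρ z : ℝ → ℂ} {R B : ℝ → ℝ}
    (hz : IsDelaySolution c a h ρ z)
    (hB : IsDelaySolution c a h (fun s => (R s : ℂ)) (fun s => (B s : ℂ)))
    (hρ : ∀ s, 0 < s → ‖ρ s‖ ≤ R s) (hinit : ∀ s ∈ Set.Icc (-h) 0, ‖z s‖ ≤ B s) :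
    ∀ t, -h ≤ t → ‖z t‖ ≤ B t := by
  have hstep : ∀ n : ℕ, ∀ t ∈ Set.Icc (-h) (n * h), ‖z t‖ ≤ B t := by
    intro n
    induction n with
    | zero => simpa using hinit
    | succ n ih =>
      intro t ht
      rcases le_or_gt t 0 with ht0 | ht0
      · exact hinit t ⟨ht.1, ht0⟩
      have hreal : (fun s => (Real.exp (-c * (t - s)) : ℂ) * (a * (B (s - h) : ℂ) + (R s : ℂ)))
          = fun s => ((Real.exp (-c * (t - s)) * (a * B (s - h) + R s) : ℝ) : ℂ) := by
        ext s
        push_cast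
        ring
      obtain ⟨-, ez⟩ := hz t ht0
      obtain ⟨iB, eB⟩ := hB t ht0
      rw [hreal] at iB eB
      have iB' : IntegrableOn (fun s => Real.exp (-c * (t - s)) * (a * B (s - h) + R s))
          (Set.Ioo 0 t) := iB.re
      rw [integral_complex_ofReal] at eB
      dsimp only at eB
      have eB' : B t = Real.exp (-c * t) * B 0
          + ∫ s in Set.Ioo 0 t, Real.exp (-c * (t - s)) * (a * B (s - h) + R s) := by
        exact_mod_cast eB
      rw [ez, eB']
      refine (norm_add_le _ _).trans (add_le_add ?_ ?_)
      · rw [norm_mul, Complex.norm_real, Real.norm_eq_abs, Real.abs_exp]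
        gcongr
        exact hinit 0 ⟨by linarith, le_rfl⟩
      · refine norm_integral_le_of_norm_le iB' ?_
        filter_upwards [ae_restrict_mem measurableSet_Ioo] with s hs
        rw [norm_mul, Complex.norm_real, Real.norm_eq_abs, Real.abs_exp]
        gcongr
        refine (norm_add_le _ _).trans (add_le_add ?_ (hρ s hs.1))
        rw [norm_mul, Complex.norm_real, Real.norm_eq_abs, abs_of_nonneg ha]
        gcongr
        refine ih _ ⟨by linarith [hs.1], ?_⟩
        have h1 := hs.2
        have h2 := ht.2
        push_cast at h2
        linarith
  intro t ht
  obtain ⟨n, hn⟩ := exists_nat_ge (t / h)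
  exact hstep n t ⟨ht, (div_le_iff₀ hh).mp hn⟩

/-- A solution with constant history `z 0` is squeezed between `z 0` times a decaying exponential
supersolution (rate `κ₁`) and `z 0` times a subsolution (rate `κ₂`). Since `z 0` is complex, the
squeeze is stated as a disc around the mean of the two barriers. -/
theorem norm_sub_barrier_le (hh : 0 < h) (ha : 0 ≤ a) {z : ℝ → ℂ}
    (hz : IsDelaySolution c a h 0 z) (hinit : ∀ s ∈ Set.Icc (-h) 0, z s = z 0) {κ₁ κ₂ : ℝ}
    (hκ₁ : 0 ≤ κ₁) (hκ₂ : 0 ≤ κ₂) (hsup : κ₁ + a * Real.exp (κ₁ * h) ≤ c)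
    (hsub : c ≤ κ₂ + a * Real.exp (κ₂ * h)) {t : ℝ} (ht : -h ≤ t) :
    ‖z t - z 0 * (((Real.exp (-κ₁ * t) + Real.exp (-κ₂ * (t + h))) / 2 : ℝ) : ℂ)‖
      ≤ ‖z 0‖ * ((Real.exp (-κ₁ * t) - Real.exp (-κ₂ * (t + h))) / 2) := by
  have hshift : ∀ s, Real.exp (-κ₂ * (s + h)) = Real.exp (-κ₂ * h) * Real.exp (-κ₂ * s) := by
    intro s
    rw [← Real.exp_add]
    congr 1
    ring
  have hE₁ := IsDelaySolution.exp c a h κ₁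
  have hE₂ := IsDelaySolution.exp c a h κ₂
  have hD := hz.linear_comb (hE₁.linear_comb hE₂ 1 (Real.exp (-κ₂ * h) : ℂ)) 1 (-(z 0 / 2))
  have hB := hE₁.linear_comb hE₂ ((‖z 0‖ / 2 : ℝ) : ℂ)
    ((-(‖z 0‖ / 2) * Real.exp (-κ₂ * h) : ℝ) : ℂ)
  simp only [← Complex.ofReal_mul, ← Complex.ofReal_add] at hB
  have key := hD.norm_le hh ha hB ?_ ?_ t ht
  · refine le_trans (le_of_eq ?_) (key.trans_eq ?_)
    · rw [hshift]
      congr 1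
      push_cast
      ring
    · rw [hshift]
      ring
  · intro s _
    have e : 1 * (0 : ℝ → ℂ) s + -(z 0 / 2) *
          (1 * (((c - κ₁ - a * Real.exp (κ₁ * h)) * Real.exp (-κ₁ * s) : ℝ) : ℂ)
            + (Real.exp (-κ₂ * h) : ℂ) *
              (((c - κ₂ - a * Real.exp (κ₂ * h)) * Real.exp (-κ₂ * s) : ℝ) : ℂ))
        = -(z 0 / 2) * (((c - κ₁ - a * Real.exp (κ₁ * h)) * Real.exp (-κ₁ * s)
            + Real.exp (-κ₂ * h) * ((c - κ₂ - a * Real.exp (κ₂ * h)) * Real.exp (-κ₂ * s))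
            : ℝ) : ℂ) := by
      rw [Pi.zero_apply]
      push_cast
      ring
    refine (congrArg norm e).trans_le ?_
    rw [norm_mul, norm_neg, norm_div, Complex.norm_real, Real.norm_eq_abs]
    have p1 : 0 ≤ (c - κ₁ - a * Real.exp (κ₁ * h)) * Real.exp (-κ₁ * s) :=
      mul_nonneg (by linarith) (Real.exp_pos _).le
    have p2 : Real.exp (-κ₂ * h) * ((c - κ₂ - a * Real.exp (κ₂ * h)) * Real.exp (-κ₂ * s)) ≤ 0 :=
      mul_nonpos_of_nonneg_of_nonpos (Real.exp_pos _).le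
        (mul_nonpos_of_nonpos_of_nonneg (by linarith) (Real.exp_pos _).le)
    have habs := (abs_add_le _ _).trans_eq (congrArg₂ (· + ·) (abs_of_nonneg p1) (abs_of_nonpos p2))
    have := mul_le_mul_of_nonneg_left habs (by positivity : 0 ≤ ‖z 0‖ / 2)
    rw [Complex.norm_ofNat]
    refine this.trans_eq ?_
    ring
  · intro s hs
    rw [hinit s hs]
    have g1 : 1 ≤ Real.exp (-κ₁ * s) := by
      rw [Real.one_le_exp_iff]
      nlinarith [hs.2]
    have g2 : Real.exp (-κ₂ * h) * Real.exp (-κ₂ * s) ≤ 1 := by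
      rw [← hshift, Real.exp_le_one_iff]
      nlinarith [hs.1]
    have e : 1 * z 0 + -(z 0 / 2) * (1 * (Real.exp (-κ₁ * s) : ℂ)
          + (Real.exp (-κ₂ * h) : ℂ) * (Real.exp (-κ₂ * s) : ℂ))
        = (z 0 / 2) * ((2 - Real.exp (-κ₁ * s)
            - Real.exp (-κ₂ * h) * Real.exp (-κ₂ * s) : ℝ) : ℂ) := by
      push_cast
      ring
    refine (congrArg norm e).trans_le ?_
    rw [norm_mul, norm_div, Complex.norm_real, Real.norm_eq_abs, Complex.norm_ofNat]
    have habs : |2 - Real.exp (-κ₁ * s) - Real.exp (-κ₂ * h) * Real.exp (-κ₂ * s)|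
        ≤ Real.exp (-κ₁ * s) - Real.exp (-κ₂ * h) * Real.exp (-κ₂ * s) := by
      rw [abs_le]
      constructor <;> linarith
    have := mul_le_mul_of_nonneg_left habs (by positivity : 0 ≤ ‖z 0‖ / 2)
    refine this.trans_eq ?_
    ring

end IsDelaySolution

/-! ### Large-time asymptotics of the delayed heat equation -/

namespace IsMildSolution

variable {a h : ℝ} {v₀ : ℝ → ℝ} {V : ℝ → ℝ → ℝ}

theorem isDelaySolution_angularFourier (ha : 0 ≤ a) (hh : 0 < h) {φ : ℝ → ℝ → ℝ}
    (hV : IsMildSolution 0 (-a) a 0 h φ V) (ξ : ℝ) :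
    IsDelaySolution (ξ ^ 2 + a) a h 0 (fun s => angularFourier (V s) ξ) := by
  intro t ht
  have he : (fun s : ℝ => (Real.exp (-(ξ ^ 2 + a) * (t - s)) : ℂ) *
        (a * angularFourier (V (s - h)) ξ + (0 : ℝ → ℂ) s))
      = fun s : ℝ => (a : ℂ) *
        ((Real.exp (-(ξ ^ 2 + a) * (t - s)) : ℂ) * angularFourier (V (s - h)) ξ) := by
    ext s
    rw [Pi.zero_apply]
    ring
  simp only [he]
  constructor
  · have hc : ContinuousOn (fun s : ℝ => (Real.exp (-(ξ ^ 2 + a) * (t - s)) : ℂ) *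
        angularFourier (V (s - h)) ξ) (Set.Icc 0 t) :=
      ContinuousOn.mul (Continuous.continuousOn (by fun_prop))
        ((hV.continuousOn_angularFourier_delay ξ).mono fun s hs => hs.1)
    exact (hc.integrableOn_Icc.mono_set Set.Ioo_subset_Icc_self).const_mul _
  · rw [integral_const_mul]
    exact hV.angularFourier_eq ha hh ht ξ

/-- The two barriers for the frequency `ξ`: the decay rates `log (1 + bξ²) / h`, with
`b = h / (1 + ah)`, and `ξ² / (1 + ah)`, enclose the exact rate `κ` of the exponential solution, given
by `ξ² = κ + a (e^{κh} - 1)`. -/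
theorem norm_angularFourier_sub_barrier_le (ha : 0 ≤ a) (hh : 0 < h)
    (hV : IsMildSolution 0 (-a) a 0 h (fun _ => v₀) V) (ξ : ℝ) {t : ℝ} (ht : -h ≤ t) :
    ‖angularFourier (V t) ξ - angularFourier (V 0) ξ *
        (((Real.exp (-(Real.log (1 + h / (1 + a * h) * ξ ^ 2) / h) * t)
          + Real.exp (-(ξ ^ 2 / (1 + a * h)) * (t + h))) / 2 : ℝ) : ℂ)‖
      ≤ ‖angularFourier (V 0) ξ‖ *
        ((Real.exp (-(Real.log (1 + h / (1 + a * h) * ξ ^ 2) / h) * t)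
          - Real.exp (-(ξ ^ 2 / (1 + a * h)) * (t + h))) / 2) := by
  have hA : 0 < 1 + a * h := by positivity
  have hb : 0 ≤ h / (1 + a * h) * ξ ^ 2 := by positivity
  refine (hV.isDelaySolution_angularFourier ha hh ξ).norm_sub_barrier_le hh ha ?_ ?_ ?_ ?_ ?_ ht
  · intro s hs
    have h0 : V 0 = v₀ := funext fun x => hV.initial 0 ⟨by linarith, le_rfl⟩ x
    have h1 : V s = v₀ := funext fun x => hV.initial s hs x
    rw [h0, h1]
  · exact div_nonneg (Real.log_nonneg (by linarith)) hh.le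
  · positivity
  · rw [div_mul_cancel₀ _ hh.ne', Real.exp_log (by linarith)]
    have h1 : Real.log (1 + h / (1 + a * h) * ξ ^ 2) / h ≤ ξ ^ 2 / (1 + a * h) := by
      rw [div_le_iff₀ hh]
      refine (Real.log_le_sub_one_of_pos (by linarith)).trans (le_of_eq ?_)
      ring
    have h2 : ξ ^ 2 / (1 + a * h) + a * (1 + h / (1 + a * h) * ξ ^ 2) = ξ ^ 2 + a := by
      field_simp
      ring
    linarith
  · have h1 := mul_le_mul_of_nonneg_left (Real.add_one_le_exp (ξ ^ 2 / (1 + a * h) * h)) ha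
    have h2 : ξ ^ 2 / (1 + a * h) + a * (ξ ^ 2 / (1 + a * h) * h + 1) = ξ ^ 2 + a := by
      field_simp
      ring
    linarith

/-- The dominating function for the rescaled transforms. By Bernoulli's inequality the algebraic
supersolution decreases in time along the parabolic scaling, so its value at `t = h` dominates. -/
theorem norm_angularFourier_rescaled_le (ha : 0 ≤ a) (hh : 0 < h)
    (hV : IsMildSolution 0 (-a) a 0 h (fun _ => v₀) V) {t : ℝ} (ht : h ≤ t) (η : ℝ) :
    ‖angularFourier (V t) (η / Real.sqrt t)‖
      ≤ (∫ x, |V 0 x|) * (1 + η ^ 2 / (1 + a * h))⁻¹ := by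
  have ht0 : 0 < t := hh.trans_le ht
  have hA : 0 < 1 + a * h := by positivity
  set ξ := η / Real.sqrt t with hξ
  have hξ2 : ξ ^ 2 = η ^ 2 / t := by rw [hξ, div_pow, Real.sq_sqrt ht0.le]
  set S := Real.exp (-(Real.log (1 + h / (1 + a * h) * ξ ^ 2) / h) * t) with hS
  set L := Real.exp (-(ξ ^ 2 / (1 + a * h)) * (t + h))
  have h1 := hV.norm_angularFourier_sub_barrier_le ha hh ξ (by linarith : -h ≤ t)
  have h2 : ‖angularFourier (V t) ξ‖ ≤ ‖angularFourier (V 0) ξ‖ * S := by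
    have h3 := norm_le_norm_sub_add (angularFourier (V t) ξ)
      (angularFourier (V 0) ξ * (((S + L) / 2 : ℝ) : ℂ))
    have hpos : 0 ≤ (S + L) / 2 := by positivity
    rw [norm_mul, Complex.norm_real, Real.norm_eq_abs, abs_of_nonneg hpos] at h3
    linarith
  refine h2.trans (mul_le_mul (norm_angularFourier_le _ _) ?_ (Real.exp_pos _).le
    (integral_nonneg fun x => abs_nonneg _))
  have hs : 0 ≤ h / (1 + a * h) * ξ ^ 2 := by positivity
  have hbern := one_add_mul_self_le_rpow_one_add (s := h / (1 + a * h) * ξ ^ 2) (by linarith)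
    (p := t / h) ((one_le_div₀ hh).mpr ht)
  have hl : t / h * (h / (1 + a * h) * ξ ^ 2) = η ^ 2 / (1 + a * h) := by
    rw [hξ2]
    field_simp
  rw [hl, Real.rpow_def_of_pos (by linarith)] at hbern
  have hS' : S = (Real.exp (Real.log (1 + h / (1 + a * h) * ξ ^ 2) * (t / h)))⁻¹ := by
    rw [hS, ← Real.exp_neg]
    congr 1
    ring
  rw [hS']
  exact inv_anti₀ (by positivity) hbern

/-- On the parabolic scale both barriers tend to the same Gaussian, hence so does the transform. -/
theorem tendsto_angularFourier_rescaled (ha : 0 ≤ a) (hh : 0 < h)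
    (hV : IsMildSolution 0 (-a) a 0 h (fun _ => v₀) V) (η : ℝ) :
    Tendsto (fun t => angularFourier (V t) (η / Real.sqrt t)) atTop
      (𝓝 ((∫ x, V 0 x : ℝ) * (Real.exp (-(1 / (1 + a * h)) * η ^ 2) : ℂ))) := by
  have hA : 0 < 1 + a * h := by positivity
  have hV0 : Integrable (V 0) := hV.integrable_slice (by linarith)
  set S : ℝ → ℝ := fun t =>
    Real.exp (-(Real.log (1 + h / (1 + a * h) * (η / Real.sqrt t) ^ 2) / h) * t)
  set L : ℝ → ℝ := fun t => Real.exp (-((η / Real.sqrt t) ^ 2 / (1 + a * h)) * (t + h))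
  set g := Real.exp (-(1 / (1 + a * h)) * η ^ 2)
  have hSlim : Tendsto S atTop (𝓝 g) := by
    have h1 := (Real.tendsto_mul_log_one_add_div_atTop (η ^ 2 / (1 + a * h))).comp
      (tendsto_id.atTop_div_const hh)
    have h2 := (Real.continuous_exp.tendsto _).comp h1.neg
    rw [show -(η ^ 2 / (1 + a * h)) = -(1 / (1 + a * h)) * η ^ 2 by ring] at h2
    refine h2.congr' ?_
    filter_upwards [eventually_gt_atTop 0] with t ht
    simp only [S, Function.comp, id]
    rw [div_pow, Real.sq_sqrt ht.le]
    have : η ^ 2 / (1 + a * h) / (t / h) = h / (1 + a * h) * (η ^ 2 / t) := by field_simp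
    rw [this]
    congr 1
    ring
  have hLlim : Tendsto L atTop (𝓝 g) := by
    have h1 : Tendsto (fun t : ℝ => -(1 / (1 + a * h)) * η ^ 2 * (1 + h * t⁻¹)) atTop
        (𝓝 (-(1 / (1 + a * h)) * η ^ 2 * (1 + h * 0))) :=
      ((tendsto_inv_atTop_zero.const_mul h).const_add 1).const_mul _
    rw [mul_zero, add_zero, mul_one] at h1
    refine ((Real.continuous_exp.tendsto _).comp h1).congr' ?_
    filter_upwards [eventually_gt_atTop 0] with t ht
    simp only [L, Function.comp]
    rw [div_pow, Real.sq_sqrt ht.le]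
    congr 1
    field_simp
  have hFlim : Tendsto (fun t : ℝ => angularFourier (V 0) (η / Real.sqrt t)) atTop
      (𝓝 ((∫ x, V 0 x : ℝ) : ℂ)) := by
    rw [← angularFourier_zero]
    refine ((continuous_angularFourier hV0).tendsto 0).comp ?_
    exact Real.tendsto_sqrt_atTop.const_div_atTop η
  have hmain : Tendsto (fun t => angularFourier (V 0) (η / Real.sqrt t) *
      (((S t + L t) / 2 : ℝ) : ℂ)) atTop (𝓝 ((∫ x, V 0 x : ℝ) * (g : ℂ))) := by
    refine hFlim.mul ((Complex.continuous_ofReal.tendsto g).comp ?_)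
    have := (hSlim.add hLlim).div_const 2
    rwa [add_self_div_two] at this
  have herr : Tendsto (fun t => angularFourier (V t) (η / Real.sqrt t) -
      angularFourier (V 0) (η / Real.sqrt t) * (((S t + L t) / 2 : ℝ) : ℂ)) atTop (𝓝 0) := by
    have hbound : Tendsto (fun t => ‖angularFourier (V 0) (η / Real.sqrt t)‖ *
        ((S t - L t) / 2)) atTop (𝓝 0) := by
      have := hFlim.norm.mul ((hSlim.sub hLlim).div_const 2)
      simpa using this
    refine squeeze_zero_norm' ?_ hbound
    filter_upwards [eventually_ge_atTop 0] with t ht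
    exact hV.norm_angularFourier_sub_barrier_le ha hh _ (by linarith)
  simpa using herr.add hmain

/-- Solutions with constant history look, for large times, like the heat kernel with diffusivity
`1 / (1 + ah)` carrying the mass of the history. -/
theorem tendsto_sqrt_mul (ha : 0 ≤ a) (hh : 0 < h)
    (hV : IsMildSolution 0 (-a) a 0 h (fun _ => v₀) V) {y : ℝ → ℝ}
    (hy : Tendsto (fun t => y t / Real.sqrt t) atTop (𝓝 0)) :
    Tendsto (fun t => Real.sqrt t * V t (y t)) atTop
      (𝓝 (Real.sqrt (1 + h * a) / (2 * Real.sqrt Real.pi) * ∫ x, v₀ x)) := by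
  have hA : 0 < 1 + a * h := by positivity
  have hv : V 0 = v₀ := funext fun x => hV.initial 0 ⟨by linarith, le_rfl⟩ x
  set M : ℝ := ∫ x, v₀ x with hM
  have hlim : Tendsto (fun t => ∫ η : ℝ, Complex.exp (Complex.I * η * (y t / Real.sqrt t : ℝ)) *
      angularFourier (V t) (η / Real.sqrt t)) atTop
      (𝓝 (∫ η : ℝ, ((M : ℂ) * (Real.exp (-(1 / (1 + a * h)) * η ^ 2) : ℂ)))) := by
    refine tendsto_integral_filter_of_dominated_convergence
      (fun η => (∫ x, |V 0 x|) * (1 + η ^ 2 / (1 + a * h))⁻¹) ?_ ?_ ?_ ?_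
    · filter_upwards [eventually_ge_atTop 0] with t ht
      have hVt : Integrable (V t) := hV.integrable_slice (by linarith)
      refine Continuous.aestronglyMeasurable (Continuous.mul (by fun_prop) ?_)
      exact (continuous_angularFourier hVt).comp (continuous_id.div_const _)
    · filter_upwards [eventually_ge_atTop h] with t ht
      refine Eventually.of_forall fun η => ?_
      rw [norm_mul, norm_exp_I_mul, one_mul]
      exact hV.norm_angularFourier_rescaled_le ha hh ht η
    · have h1 := integrable_inv_one_add_sq.comp_div
        (Real.sqrt_pos.mpr hA).ne'
      simp only [div_pow, Real.sq_sqrt hA.le] at h1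
      exact h1.const_mul _
    · refine Eventually.of_forall fun η => ?_
      have h1 : Tendsto (fun t => Complex.exp (Complex.I * η * (y t / Real.sqrt t : ℝ))) atTop
          (𝓝 1) := by
        have hc : Continuous fun r : ℝ => Complex.exp (Complex.I * η * (r : ℝ)) := by fun_prop
        have h0 := (hc.tendsto 0).comp hy
        rwa [Complex.ofReal_zero, mul_zero, Complex.exp_zero] at h0
      have h2 := h1.mul (hV.tendsto_angularFourier_rescaled ha hh η)
      rwa [one_mul, hv] at h2
  have hval : 1 / (2 * Real.pi) * ∫ η : ℝ, ((M : ℂ) * (Real.exp (-(1 / (1 + a * h)) * η ^ 2) : ℂ))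
      = ((Real.sqrt (1 + h * a) / (2 * Real.sqrt Real.pi) * M : ℝ) : ℂ) := by
    rw [integral_const_mul, integral_complex_ofReal, integral_gaussian]
    have : Real.sqrt (Real.pi / (1 / (1 + a * h))) = Real.sqrt Real.pi * Real.sqrt (1 + h * a) := by
      rw [← Real.sqrt_mul Real.pi_pos.le]
      congr 1
      field_simp
    rw [this]
    have hpi : 1 / (2 * Real.pi) * (M * (Real.sqrt Real.pi * Real.sqrt (1 + h * a)))
        = Real.sqrt (1 + h * a) / (2 * Real.sqrt Real.pi) * M := by
      have hs : Real.sqrt Real.pi ≠ 0 := (Real.sqrt_pos.mpr Real.pi_pos).ne'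
      have hs2 : Real.pi = Real.sqrt Real.pi * Real.sqrt Real.pi :=
        (Real.mul_self_sqrt Real.pi_pos.le).symm
      nth_rewrite 1 [hs2]
      field_simp
    rw [← hpi]
    push_cast
    ring
  have hcomplex : Tendsto (fun t => ((Real.sqrt t * V t (y t) : ℝ) : ℂ)) atTop
      (𝓝 ((Real.sqrt (1 + h * a) / (2 * Real.sqrt Real.pi) * M : ℝ) : ℂ)) := by
    rw [← hval]
    refine (hlim.const_mul _).congr' ?_
    filter_upwards [eventually_gt_atTop 0] with t ht
    have hst : 0 < Real.sqrt t := Real.sqrt_pos.mpr ht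
    rw [Complex.ofReal_mul, hV.eq_integral_angularFourier ha hh ht]
    -- the substitution `η = √t ξ`
    have hsub := Measure.integral_comp_div
      (fun ξ : ℝ => Complex.exp (Complex.I * ξ * (y t : ℝ)) * angularFourier (V t) ξ) (Real.sqrt t)
    rw [abs_of_pos hst, Complex.real_smul] at hsub
    rw [mul_left_comm, ← hsub]
    congr 2
    ext η
    congr 2
    push_cast
    ring
  exact (Complex.continuous_re.tendsto _).comp hcomplex

end IsMildSolution

/-! ### Removing the drift and the exponential growth -/

theorem exp_mul_driftHeatKernel (m p σ a t z : ℝ) (ha : a = σ + m ^ 2 / 4 - p) :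
    Real.exp (-σ * t) * Real.exp (m / 2 * z) * driftHeatKernel m p t z
      = driftHeatKernel 0 (-a) t z := by
  rcases eq_or_ne t 0 with rfl | ht
  -- at `t = 0` both kernels vanish, since division by `√0` gives `0`
  · simp [driftHeatKernel]
  unfold driftHeatKernel
  have key : Real.exp (-σ * t) * Real.exp (m / 2 * z) * Real.exp (p * t)
        * Real.exp (-(z + m * t) ^ 2 / (4 * t))
      = Real.exp (-a * t) * Real.exp (-(z + 0 * t) ^ 2 / (4 * t)) := by
    simp only [← Real.exp_add]
    congr 1
    rw [ha]
    field_simp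
    ring
  calc _ = Real.exp (-σ * t) * Real.exp (m / 2 * z) * Real.exp (p * t)
        * Real.exp (-(z + m * t) ^ 2 / (4 * t)) / Real.sqrt (4 * Real.pi * t) := by ring
    _ = _ := by rw [key]; ring

/-- The gauge transformation `V(t,x) = e^{-σt} e^{mx/2} u(t,x)` removes the drift, balances the decay
against the delayed term, and turns the history `e^{σs} u₀` into a constant one. -/
theorem IsMildSolution.gauge {m p q h σ : ℝ}
    (hσ : q * Real.exp (-σ * h) = σ + m ^ 2 / 4 - p) {u₀ : ℝ → ℝ} {u : ℝ → ℝ → ℝ}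
    (hu : IsMildSolution m p q 0 h (fun s x => Real.exp (σ * s) * u₀ x) u) :
    IsMildSolution 0 (-(q * Real.exp (-σ * h))) (q * Real.exp (-σ * h)) 0 h
      (fun _ x => Real.exp (m / 2 * x) * u₀ x)
      (fun t x => Real.exp (-σ * t) * (Real.exp (m / 2 * x) * u t x)) where
  aestronglyMeasurable := by
    have h1 : AEStronglyMeasurable
        (fun z : ℝ × ℝ => Real.exp (-σ * z.1) * (Real.exp (m / 2 * z.2) * Function.uncurry u z))
        ((volume : Measure (ℝ × ℝ)).restrict (Set.Ici (-h) ×ˢ Set.univ)) :=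
      AEStronglyMeasurable.mul (Continuous.aestronglyMeasurable (by fun_prop))
        (AEStronglyMeasurable.mul (Continuous.aestronglyMeasurable (by fun_prop))
          hu.aestronglyMeasurable)
    exact h1
  integrable := by
    intro t ht
    simpa using (hu.integrable t ht).const_mul (Real.exp (-σ * t))
  continuous := by
    intro t₀ ht₀
    have hi₀ := hu.integrable t₀ ht₀
    have hexp : Tendsto (fun t => Real.exp (-σ * t)) (𝓝[Set.Ici (-h)] t₀)
        (𝓝 (Real.exp (-σ * t₀))) :=
      ((by fun_prop : Continuous fun t : ℝ => Real.exp (-σ * t)).tendsto t₀).mono_left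
        nhdsWithin_le_nhds
    have hlim : Tendsto (fun t =>
        Real.exp (-σ * t) * (∫ x, Real.exp (m / 2 * x) * |u t x - u t₀ x|)
        + |Real.exp (-σ * t) - Real.exp (-σ * t₀)| * ∫ x, |Real.exp (m / 2 * x) * u t₀ x|)
        (𝓝[Set.Ici (-h)] t₀) (𝓝 0) := by
      have h1 := hexp.mul (hu.continuous t₀ ht₀)
      have h2 := ((hexp.sub_const (Real.exp (-σ * t₀))).abs).mul_const
        (∫ x, |Real.exp (m / 2 * x) * u t₀ x|)
      simpa using h1.add h2
    refine squeeze_zero' (Eventually.of_forall fun t => integral_nonneg fun x => by positivity) ?_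
      hlim
    filter_upwards [self_mem_nhdsWithin] with t ht
    have hi := hu.integrable t ht
    have hid : Integrable (fun x => Real.exp (m / 2 * x) * |u t x - u t₀ x|) := by
      refine (hi.sub hi₀).abs.congr (Eventually.of_forall fun x => ?_)
      simp only [Pi.sub_apply]
      rw [← mul_sub, abs_mul, Real.abs_exp]
    rw [← integral_const_mul, ← integral_const_mul,
      ← integral_add (hid.const_mul _) (hi₀.abs.const_mul _)]
    refine integral_mono_of_nonneg (Eventually.of_forall fun x => by positivity)
      ((hid.const_mul _).add (hi₀.abs.const_mul _)) (Eventually.of_forall fun x => ?_)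
    simp only [zero_div, zero_mul, Real.exp_zero, one_mul]
    have e : Real.exp (-σ * t) * (Real.exp (m / 2 * x) * u t x)
          - Real.exp (-σ * t₀) * (Real.exp (m / 2 * x) * u t₀ x)
        = Real.exp (-σ * t) * (Real.exp (m / 2 * x) * (u t x - u t₀ x))
          + (Real.exp (-σ * t) - Real.exp (-σ * t₀)) * (Real.exp (m / 2 * x) * u t₀ x) := by
      ring
    rw [e]
    refine (abs_add_le _ _).trans (le_of_eq ?_)
    rw [abs_mul, abs_mul, abs_mul]
    simp only [Real.abs_exp]
  initial := by
    intro s hs x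
    simp only [hu.initial s hs x]
    have : Real.exp (-σ * s) * Real.exp (σ * s) = 1 := by
      rw [← Real.exp_add]
      simp
    linear_combination (Real.exp (m / 2 * x) * u₀ x) * this
  duhamel := by
    intro t ht x
    have hk := fun τ z => exp_mul_driftHeatKernel m p σ _ τ z hσ
    have hx : ∀ y, Real.exp (m / 2 * x) = Real.exp (m / 2 * (x - y)) * Real.exp (m / 2 * y) := by
      intro y
      rw [← Real.exp_add]
      congr 1
      ring
    rw [hu.duhamel t ht x, mul_add, mul_add]
    congr 1
    · rw [← integral_const_mul, ← integral_const_mul]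
      congr 1
      ext y
      rw [← hk, hx y]
      simp only [mul_zero, Real.exp_zero, one_mul]
      ring
    · have hs : Real.exp (-σ * t) * (Real.exp (m / 2 * x) * ∫ s in (0 : ℝ)..t, ∫ y,
            driftHeatKernel m p (t - s) (x - y) * u (s - h) (y + 0))
          = Real.exp (-σ * h) * ∫ s in (0 : ℝ)..t, ∫ y,
            driftHeatKernel 0 (-(q * Real.exp (-σ * h))) (t - s) (x - y) *
              (Real.exp (-σ * (s - h)) * (Real.exp (m / 2 * (y + 0)) * u (s - h) (y + 0))) := by
        simp only [← intervalIntegral.integral_const_mul, ← integral_const_mul]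
        congr 1
        ext s
        congr 1
        ext y
        have ht' : Real.exp (-σ * t)
            = Real.exp (-σ * h) * Real.exp (-σ * (t - s)) * Real.exp (-σ * (s - h)) := by
          rw [← Real.exp_add, ← Real.exp_add]
          congr 1
          ring
        rw [← hk, hx y, ht', add_zero]
        ring
      linear_combination q * hs

theorem existsUnique_growth_rate (m p q h : ℝ) (hh : 0 < h) (hq : 0 ≤ q) :
    ∃! σ : ℝ, q * Real.exp (-σ * h) = σ + m ^ 2 / 4 - p := by
  set f : ℝ → ℝ := fun σ => σ + m ^ 2 / 4 - p - q * Real.exp (-σ * h) with hf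
  have hcont : Continuous f := by fun_prop
  have hmono : StrictMono f := by
    intro x y hxy
    have h1 : Real.exp (-y * h) ≤ Real.exp (-x * h) := Real.exp_le_exp.mpr (by nlinarith)
    have h2 := mul_le_mul_of_nonneg_left h1 hq
    simp only [hf]
    linarith
  have hlow : f (p - m ^ 2 / 4) ≤ 0 := by
    have : 0 ≤ q * Real.exp (-(p - m ^ 2 / 4) * h) := by positivity
    simp only [hf]
    linarith
  have hhigh : 0 ≤ f (|p - m ^ 2 / 4| + q) := by
    have h1 : Real.exp (-(|p - m ^ 2 / 4| + q) * h) ≤ 1 := by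
      rw [Real.exp_le_one_iff]
      have : 0 ≤ (|p - m ^ 2 / 4| + q) * h := by positivity
      linarith
    have h2 := mul_le_mul_of_nonneg_left h1 hq
    have h3 := le_abs_self (p - m ^ 2 / 4)
    simp only [hf]
    linarith
  obtain ⟨σ, hσ⟩ := mem_range_of_exists_le_of_exists_ge hcont ⟨_, hlow⟩ ⟨_, hhigh⟩
  refine ⟨σ, ?_, fun τ hτ => hmono.injective ?_⟩
  · simp only [hf] at hσ
    linarith
  · rw [hσ]
    simp only [hf]
    linarith

theorem mainTheorem5 (m p q h : ℝ) (hh : 0 < h) (hq : 0 ≤ q) :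
    (∃! σ : ℝ, q * Real.exp (-σ * h) = σ + m ^ 2 / 4 - p) ∧
    ∀ σ : ℝ, q * Real.exp (-σ * h) = σ + m ^ 2 / 4 - p →
    ∀ u₀ : ℝ → ℝ, Integrable (fun x => Real.exp (m / 2 * x) * u₀ x) →
    ∀ u : ℝ → ℝ → ℝ, IsMildSolution m p q 0 h (fun s x => Real.exp (σ * s) * u₀ x) u →
    ∀ (x : ℝ) (r : ℝ → ℝ), r =o[atTop] (fun t => Real.sqrt t) →
      Tendsto
        (fun t => Real.sqrt t * Real.exp (-σ * t) * (Real.exp (m / 2 * r t) * u t (x + r t)))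
        atTop
        (𝓝 (Real.sqrt (1 + h * q * Real.exp (-σ * h)) / (2 * Real.sqrt Real.pi)
          * Real.exp (-(m / 2) * x) * ∫ y, Real.exp (m / 2 * y) * u₀ y)) ∧
      (Tendsto (fun t => m * r t) atTop (𝓝 0) →
        Tendsto
          (fun t => Real.sqrt t * Real.exp (-σ * t) * u t (x + r t))
          atTop
          (𝓝 (Real.sqrt (1 + h * q * Real.exp (-σ * h)) / (2 * Real.sqrt Real.pi)
            * Real.exp (-(m / 2) * x) * ∫ y, Real.exp (m / 2 * y) * u₀ y))) := by
  refine ⟨existsUnique_growth_rate m p q h hh hq, fun σ hσ u₀ _ u hu x r hr => ?_⟩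
  have ha : 0 ≤ q * Real.exp (-σ * h) := by positivity
  have hy : Tendsto (fun t => (x + r t) / Real.sqrt t) atTop (𝓝 0) := by
    have h1 : Tendsto (fun t => x / Real.sqrt t) atTop (𝓝 0) :=
      Real.tendsto_sqrt_atTop.const_div_atTop x
    simpa [add_div] using h1.add hr.tendsto_div_nhds_zero
  have key := ((hu.gauge hσ).tendsto_sqrt_mul ha hh hy).const_mul (Real.exp (-(m / 2) * x))
  have hfirst : Tendsto
      (fun t => Real.sqrt t * Real.exp (-σ * t) * (Real.exp (m / 2 * r t) * u t (x + r t)))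
      atTop
      (𝓝 (Real.sqrt (1 + h * q * Real.exp (-σ * h)) / (2 * Real.sqrt Real.pi)
        * Real.exp (-(m / 2) * x) * ∫ y, Real.exp (m / 2 * y) * u₀ y)) := by
    have hl : Real.exp (-(m / 2) * x) * (Real.sqrt (1 + h * (q * Real.exp (-σ * h)))
          / (2 * Real.sqrt Real.pi) * ∫ y, Real.exp (m / 2 * y) * u₀ y)
        = Real.sqrt (1 + h * q * Real.exp (-σ * h)) / (2 * Real.sqrt Real.pi)
          * Real.exp (-(m / 2) * x) * ∫ y, Real.exp (m / 2 * y) * u₀ y := by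
      rw [← mul_assoc h]
      ring
    rw [hl] at key
    refine key.congr fun t => ?_
    have hr' : Real.exp (m / 2 * r t)
        = Real.exp (-(m / 2) * x) * Real.exp (m / 2 * (x + r t)) := by
      rw [← Real.exp_add]
      congr 1
      ring
    rw [hr']
    ring
  refine ⟨hfirst, fun hm => ?_⟩
  have hexp : Tendsto (fun t => Real.exp (-(1 / 2) * (m * r t))) atTop (𝓝 1) := by
    have := (Real.continuous_exp.tendsto _).comp (hm.const_mul (-(1 / 2)))
    rwa [mul_zero, Real.exp_zero] at this
  have hprod := hexp.mul hfirst
  rw [one_mul] at hprod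
  refine hprod.congr fun t => ?_
  have hcancel : Real.exp (-(1 / 2) * (m * r t)) * Real.exp (m / 2 * r t) = 1 := by
    rw [← Real.exp_add, Real.exp_eq_one_iff]
    ring
  linear_combination (Real.sqrt t * Real.exp (-σ * t) * u t (x + r t)) * hcancel
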